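/- Let $\mathbb{T}=\mathbb{R}\cup\{-\infty\}$ be the max-tropical semiring, with $\oplus=\max$ and $\odot=+$. For $V\subseteq\mathbb{T}^d$ let $$\operatorname{tconv}(V)=\Big\{\bigoplus_{j=1}^n\lambda_j\odot v_j : n\ge 1,\ \lambda_j\in\mathbb{T},\ v_j\in V,\ \bigoplus_{j=1}^n\lambda_j=0\Big\}.$$ A tropical polytope is a set $P=\operatorname{tconv}(V)$ with $V$ finite; its vertices are the elements of its minimal generating set. $P$ is a (canonical) tropical lattice polytope if its vertices lie in $\mathbb{TN}^d=(\mathbb{Z}_{\ge0}\cup\{-\infty\})^d$. For an integer $b\ge2$ put $\Gamma_b^d=(\log_b\mathbb{Z}_{\ge0})^d$ with $\log_b 0=-\infty$, and let $$\mathfrak{L}_P^b(k)=\#\big((k\odot P)\cap\Gamma_b^d\big),\qquad k\in\mathbb{Z}_{\ge0},$$ where $k\odot P=\{(k+x_1,\dots,k+x_d):x\in P\}$. The covector of $x\in P$ is the set of pairs $(v,i)$, with $v$ a vertex of $P$ and $i\in\{0,1,\dots,d\}$, for which $x_i\neq-\infty$ and there is $\lambda\in\mathbb{T}$ with $\lambda\odot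 v_{i'}\le x_{i'}$ for all $i'\in\{0,\dots,d\}$ and equality for $i'=i$ (here $x_0=v_0=0$). The relatively open cells of the covector decomposition of $P$ are the sets of points of $P$ with the same covector; a pseudovertex of $P$ is a point that forms a cell by itself. **Theorem (Tropical Ehrhart polynomial).** Let $b\ge2$ be an integer and let $P\subseteq\mathbb{T}^d$ be a tropical lattice polytope. Then $\mathfrak{L}_P^b(k)$ is finite for every $k\in\mathbb{Z}_{\ge0}$, and: 1. If all pseudovertices of $P$ lie in $\mathbb{TN}^d$ (equivalently, all pseudovertices of $\exp_b(P)$ are lattice points, i.e. $\exp_b(P)$ is a lattice polytope over $(\mathbb{R}_{\ge0},\max,\cdot)$), then there is a polynomial $q\in\mathbb{R}[X]$ with $\mathfrak{L}_P^b(k)=q(b^k)$ for all $k\in\mathbb{Z}_{\ge0}$. 2. In particular, if all vertices of $P$ have only finite coordinates, i.e. lie in $\mathbb{Z}_{\ge0}^d$, then there is a polynomial $q\in\mathbb{R}[X]$ with $\mathfrak{L}_P^b(k)=q(b^k)$ for all $k\in\mathbb{Z}_{\ge0}$. 3. In general, there are a polynomial $q\in\mathbb{R}[X]$ and $K\in\mathbb{Z}_{\ge0}$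 with $\mathfrak{L}_P^b(k)=q(b^k)$ for all integers $k\ge K$. -/

import Mathlib

noncomputable section

/-- The carrier `ℝ ∪ {-∞}` of the max-tropical semiring: tropical addition is `⊔` (maximum), tropical
multiplication is `+`, the tropical zero `-∞` is `⊥` and the tropical one is `0`. -/
abbrev MaxTrop : Type := WithBot ℝ

/-- The tropical convex hull of `V ⊆ 𝕋^d`: all `⊕_j lam_j ⊙ v_j` with `⊕_j lam_j = 0`, `v_j ∈ V`. -/
def tropConv {d : ℕ} (V : Set (Fin d → MaxTrop)) : Set (Fin d → MaxTrop) :=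
  {x | ∃ (n : ℕ) (lam : Fin n → MaxTrop) (v : Fin n → Fin d → MaxTrop),
    (∀ j, v j ∈ V) ∧ Finset.univ.sup lam = 0 ∧
    x = fun i => Finset.univ.sup fun j => lam j + v j i}

/-- `P` is a tropical polytope and `V` is its set of vertices: `V` is finite and is a minimal set
with tropical convex hull `P`. -/
def IsTropVertexSet {d : ℕ} (P V : Set (Fin d → MaxTrop)) : Prop :=
  V.Finite ∧ Minimal (fun W : Set (Fin d → MaxTrop) => tropConv W = P) V

/-- `(ℤ_{≥ 0} ∪ {-∞})^d`. -/
def tropNat (d : ℕ) : Set (Fin d → MaxTrop) :=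
  {x | ∀ i, x i = ⊥ ∨ ∃ m : ℕ, x i = (((m : ℝ)) : MaxTrop)}

/-- `log_b n`, with `log_b 0 = -∞`. -/
def tropLog (b n : ℕ) : MaxTrop :=
  if n = 0 then ⊥ else ((Real.logb b n : ℝ) : MaxTrop)

/-- The tropical `b`-lattice `(log_b ℤ_{≥ 0})^d`. -/
def tropLattice (b d : ℕ) : Set (Fin d → MaxTrop) :=
  {x | ∃ n : Fin d → ℕ, x = fun i => tropLog b (n i)}

/-- The tropical dilate `k ⊙ P`, where `k` is added to every coordinate of every point of `P`. -/
def tropDilate {d : ℕ} (k : ℕ) (P : Set (Fin d → MaxTrop)) : Set (Fin d → MaxTrop) :=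
  (fun x i => (((k : ℝ)) : MaxTrop) + x i) '' P

/-- The tropical lattice point enumerator `#((k ⊙ P) ∩ Γ_b^d)`. -/
def tropEnum (b : ℕ) {d : ℕ} (P : Set (Fin d → MaxTrop)) (k : ℕ) : ℕ :=
  (tropDilate k P ∩ tropLattice b d).ncard

/-- Homogenization: the coordinates of `x`, and the tropical one at the extra index `none`. -/
def tropHom {d : ℕ} (x : Fin d → MaxTrop) : Option (Fin d) → MaxTrop
  | none => 0
  | some i => x i

/-- The covector of `x` with respect to the generators `V`: all pairs `(v, i)` such that the largest
multiple of (the homogenization of) `v` below `x` touches `x` in coordinate `i`, at a finite value. -/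
def covector {d : ℕ} (V : Set (Fin d → MaxTrop)) (x : Fin d → MaxTrop) :
    Set ((Fin d → MaxTrop) × Option (Fin d)) :=
  {p | p.1 ∈ V ∧ tropHom x p.2 ≠ ⊥ ∧
    ∃ lam : MaxTrop, (∀ i, lam + tropHom p.1 i ≤ tropHom x i) ∧
      lam + tropHom p.1 p.2 = tropHom x p.2}

/-- The relatively open cells of the covector decomposition of `tropConv V` are the sets of points
of `tropConv V` with a common covector; a pseudovertex is a point that is a cell by itself. -/
def IsPseudovertex {d : ℕ} (V : Set (Fin d → MaxTrop)) (x : Fin d → MaxTrop) : Prop :=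
  x ∈ tropConv V ∧ ∀ y ∈ tropConv V, covector V y = covector V x → y = x

end

/-! The exponential with base `b` turns `k ⊙ P` into an ordinary dilate by `b ^ k` of a max-times
polytope, and `Γ_b^d` into the nonnegative integer points. In these multiplicative coordinates a
covector is described by homogeneous linear inequalities `w v i * y j ≤ w v j * y i`, so each closed
covector cell is an ordinary compact convex polytope, and finitely many relatively open cells
partition `exp_b(P)`. Hence the enumerator is a finite sum of classical Ehrhart counts taken at the
factor `N = b ^ k`.

Two facts make this work. An extreme point of a closed cell is a pseudovertex
(`extremePoints_mulClosedCell_subset`), so if the pseudovertices are integral then all cells are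
lattice polytopes. Whether a convex combination of the pseudovertices in a closed cell lies in the
open cell depends only on its support (`mulCovector_eq_of_support`), so the open cell is a disjoint
union of open simplices of a triangulation. Taking the lexicographically maximal coefficient vector
of each point gives such a triangulation, and open lattice simplices are counted by translating a
half-open parallelepiped.

The nonzero coordinates of pseudovertices are integral powers of `b`
(`mulPseudovertices_mem_subgroup`). For finite vertices the exponents are nonnegative, so every
dilate is covered. In general a factor `b ^ K` clears the denominators, which gives a polynomial for
`k ≥ K`. -/

noncomputable section

/-! ### Polynomial counting functions -/

/-- A family of sets whose cardinality at `N ≥ 1` is finite and given by a polynomial in `N`. -/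
def PolyCount {α : Type*} (S : ℕ → Set α) : Prop :=
  ∃ q : Polynomial ℝ, ∀ N : ℕ, 1 ≤ N → (S N).Finite ∧ ((S N).ncard : ℝ) = q.eval (N : ℝ)

theorem PolyCount.congr {α : Type*} {S T : ℕ → Set α} (hS : PolyCount S)
    (h : ∀ N, 1 ≤ N → T N = S N) : PolyCount T := by
  obtain ⟨q, hq⟩ := hS
  exact ⟨q, fun N hN => by rw [h N hN]; exact hq N hN⟩

theorem PolyCount.empty {α : Type*} : PolyCount (fun _ => (∅ : Set α)) :=
  ⟨0, fun N _ => by simp⟩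

theorem PolyCount.image {α β : Type*} {S : ℕ → Set α} (hS : PolyCount S) (f : ℕ → α → β)
    (hf : ∀ N, 1 ≤ N → Set.InjOn (f N) (S N)) : PolyCount (fun N => f N '' S N) := by
  obtain ⟨q, hq⟩ := hS
  exact ⟨q, fun N hN => ⟨(hq N hN).1.image _, by
    rw [(hf N hN).ncard_image]; exact (hq N hN).2⟩⟩

theorem PolyCount.biUnion {α β : Type*} {B : Set β} (hB : B.Finite) {S : β → ℕ → Set α}
    (hS : ∀ b ∈ B, PolyCount (S b))
    (hd : ∀ N, 1 ≤ N → B.PairwiseDisjoint fun b => S b N) :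
    PolyCount (fun N => ⋃ b ∈ B, S b N) := by
  classical
  induction B, hB using Set.Finite.induction_on with
  | empty => simpa using PolyCount.empty
  | @insert a B ha hB ih =>
    obtain ⟨q, hq⟩ := ih (fun b hb => hS b (Set.mem_insert_of_mem _ hb))
      fun N hN => (hd N hN).subset (Set.subset_insert _ _)
    obtain ⟨r, hr⟩ := hS a (Set.mem_insert _ _)
    refine ⟨r + q, fun N hN => ?_⟩
    obtain ⟨h1, h2⟩ := hq N hN
    obtain ⟨h3, h4⟩ := hr N hN
    simp only [Set.biUnion_insert]
    refine ⟨h3.union h1, ?_⟩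
    rw [Set.ncard_union_eq _ h3 h1]
    · push_cast
      rw [h2, h4, Polynomial.eval_add]
    · rw [Set.disjoint_iUnion₂_right]
      intro b hb
      exact hd N hN (Set.mem_insert _ _) (Set.mem_insert_of_mem _ hb) fun h => ha (h ▸ hb)

/-- The number of compositions of `N - h` into `#I` natural numbers is a polynomial in `N`
with the correct value `0` also for `1 ≤ N < h ≤ #I`. -/
theorem PolyCount.compositions (I : Type*) [Fintype I] (h : ℕ) (h1 : 1 ≤ h)
    (h2 : h ≤ Fintype.card I) :
    PolyCount (fun N => {n : I → ℕ | ∑ i, n i + h = N}) := by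
  classical
  obtain ⟨m, hm⟩ : ∃ m, Fintype.card I = m + 1 := ⟨Fintype.card I - 1, by omega⟩
  refine ⟨Polynomial.preHilbertPoly ℝ m h, fun N hN => ?_⟩
  beta_reduce
  rcases le_or_gt h N with hle | hlt
  · have e : {n : I → ℕ | ∑ i, n i + h = N} = {n : I → ℕ | ∑ i, n i = N - h} := by
      ext n; simp only [Set.mem_ofPred_eq]; omega
    have eq := Sym.equivNatSumOfFintype I (N - h)
    rw [e]
    constructor
    · exact Set.finite_coe_iff.1 (Finite.of_equiv _ eq)
    · rw [Polynomial.preHilbertPoly_eq_choose_sub_add _ _ hle]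
      have h3 : ({n : I → ℕ | ∑ i, n i = N - h}).ncard = Nat.card (Sym I (N - h)) :=
        (Nat.card_congr eq).symm
      rw [h3, Nat.card_eq_fintype_card, Sym.card_sym_eq_choose, hm]
      congr 1
      rw [show m + 1 + (N - h) - 1 = N - h + m by omega, ← Nat.choose_symm_add]
  · have e : {n : I → ℕ | ∑ i, n i + h = N} = ∅ := by
      ext n; simp only [Set.mem_ofPred_eq, Set.mem_empty_iff_false, iff_false]; omega
    rw [e]
    refine ⟨Set.finite_empty, ?_⟩
    -- The rising factorial of length `m` starts at the nonpositive integer `N - h + 1` and passes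
    -- through zero, because `h - N - 1 < m`. This uses `1 ≤ N`: it fails at `N = 0` when `h = m +
    -- 1`.
    have h3 : (ascPochhammer ℝ m).eval ((N : ℝ) - h + 1) = 0 := by
      rw [ascPochhammer_eval_eq_zero_iff]
      refine ⟨h - N - 1, by omega, ?_⟩
      rw [Nat.cast_sub (by omega), Nat.cast_sub (by omega)]
      push_cast; ring
    simp [Polynomial.preHilbertPoly, h3]


/-! ### Lattice points of open simplices -/

/-- Ehrhart polynomiality for the integral points in dilates of a relatively open lattice simplex,
in terms of the coefficient vectors. -/
theorem PolyCount.openSimplex {I κ : Type*} [Fintype I] [Finite κ] (u : I → κ → ℤ) (k₀ : κ)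
    (hu : ∀ p, u p k₀ = 1)
    (hinj : Function.Injective fun (l : I → ℝ) k => ∑ p, l p * (u p k : ℝ)) :
    PolyCount (fun N => {l : I → ℝ | (∀ p, 0 < l p) ∧
      (∀ k, ∃ m : ℤ, ∑ p, l p * (u p k : ℝ) = m) ∧ ∑ p, l p = N}) := by
  classical
  cases nonempty_fintype κ
  -- Lattice points of the half-open fundamental parallelepiped. The interval is `(0, 1]`, not `[0,
  -- 1)`, because the coefficients of an interior point are positive: each splits uniquely as `f p +
  -- n p` with `f p` in `(0, 1]` and `n p` natural.
  set F : Set (I → ℝ) := {f | (∀ p, 0 < f p ∧ f p ≤ 1) ∧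
    ∀ k, ∃ m : ℤ, ∑ p, f p * (u p k : ℝ) = m} with hF
  have hFfin : F.Finite := by
    have hfin : (Set.univ.pi fun k => ((↑) : ℤ → ℝ) ''
        Set.Icc (-(∑ p, |u p k|)) (∑ p, |u p k|)).Finite :=
      Set.Finite.pi fun k => (Set.finite_Icc _ _).image _
    refine (hfin.preimage hinj.injOn).subset ?_
    rintro f ⟨hf1, hf2⟩ k -
    obtain ⟨m, hm⟩ := hf2 k
    refine ⟨m, ?_, hm.symm⟩
    rw [Set.mem_Icc, ← abs_le]
    have : |(m : ℝ)| ≤ ∑ p, |(u p k : ℝ)| := by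
      rw [← hm]
      refine (Finset.abs_sum_le_sum_abs _ _).trans (Finset.sum_le_sum fun p _ => ?_)
      rw [abs_mul, abs_of_pos (hf1 p).1]
      exact mul_le_of_le_one_left (abs_nonneg _) (hf1 p).2
    exact_mod_cast this
  -- Coordinate `k₀` of a lattice point is its coefficient sum, so this height is an integer.
  have hht : ∀ f ∈ F, ∃ h : ℕ, ∑ p, f p = h := by
    rintro f ⟨hf1, hf2⟩
    obtain ⟨m, hm⟩ := hf2 k₀
    simp only [hu, Int.cast_one, mul_one] at hm
    have h0 : (0 : ℝ) ≤ m := hm ▸ Finset.sum_nonneg fun p _ => (hf1 p).1.le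
    lift m to ℕ using by exact_mod_cast h0
    exact ⟨m, by simpa using hm⟩
  choose! h hh using hht
  have key : ∀ N : ℕ, 1 ≤ N → {l : I → ℝ | (∀ p, 0 < l p) ∧
      (∀ k, ∃ m : ℤ, ∑ p, l p * (u p k : ℝ) = m) ∧ ∑ p, l p = N} =
      ⋃ f ∈ F, (fun (n : I → ℕ) p => f p + n p) '' {n : I → ℕ | ∑ i, n i + h f = N} := by
    intro N hN
    ext l
    simp only [Set.mem_ofPred_eq, Set.mem_iUnion, Set.mem_image, exists_prop]
    constructor
    · rintro ⟨hpos, hint, hsum⟩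
      have hc : ∀ p, 1 ≤ ⌈l p⌉₊ := fun p => Nat.one_le_ceil_iff.2 (hpos p)
      have hcr : ∀ p, ((⌈l p⌉₊ - 1 : ℕ) : ℝ) = ⌈l p⌉₊ - 1 := fun p => by
        rw [Nat.cast_sub (hc p)]; simp
      have hfF : (fun p => l p - (⌈l p⌉₊ - 1 : ℕ)) ∈ F := by
        refine ⟨fun p => ?_, fun k => ?_⟩
        · beta_reduce
          rw [hcr]
          have h1 := Nat.le_ceil (l p)
          have h2 := Nat.ceil_lt_add_one (hpos p).le
          constructor <;> linarith
        · obtain ⟨m, hm⟩ := hint k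
          refine ⟨m - ∑ p, ((⌈l p⌉₊ - 1 : ℕ) : ℤ) * u p k, ?_⟩
          push_cast [sub_mul, Finset.sum_sub_distrib]
          rw [hm]
      refine ⟨_, hfF, fun p => ⌈l p⌉₊ - 1, ?_, ?_⟩
      · have := hh _ hfF
        rw [Finset.sum_sub_distrib, hsum] at this
        have h3 : ((∑ p, (⌈l p⌉₊ - 1) + h (fun p => l p - (⌈l p⌉₊ - 1 : ℕ)) : ℕ) : ℝ) = N := by
          push_cast
          linarith
        exact_mod_cast h3
      · ext p; simp
    · rintro ⟨f, hf, n, hn, rfl⟩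
      refine ⟨fun p => ?_, fun k => ?_, ?_⟩
      · have := (hf.1 p).1
        positivity
      · obtain ⟨m, hm⟩ := hf.2 k
        refine ⟨m + ∑ p, (n p : ℤ) * u p k, ?_⟩
        push_cast [add_mul, Finset.sum_add_distrib]
        rw [hm]
      · rw [Finset.sum_add_distrib, hh f hf, ← hn]
        push_cast
        ring
  refine PolyCount.congr (PolyCount.biUnion hFfin (fun f hf => ?_) ?_) key
  · have hI : ∀ N : ℕ, 1 ≤ N → Set.InjOn (fun (n : I → ℕ) p => f p + (n p : ℝ))
        {n : I → ℕ | ∑ i, n i + h f = N} := fun N _ n _ n' _ hnn => by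
      ext p
      simpa using congrFun hnn p
    -- For empty `I` the height is `0`, outside the range of `PolyCount.compositions`, but then no
    -- `N ≥ 1` has a point.
    rcases isEmpty_or_nonempty I with hI' | hI'
    · refine PolyCount.congr PolyCount.empty fun N hN => ?_
      have h0 : h f = 0 := by simpa using (hh f hf).symm
      simp only [Finset.univ_eq_empty, Finset.sum_empty, h0, Set.image_eq_empty]
      ext n
      simp only [Set.mem_ofPred_eq, Set.mem_empty_iff_false, iff_false]
      omega
    · refine PolyCount.image (PolyCount.compositions I (h f) ?_ ?_) (fun _ => _) hI
      · have : (0 : ℝ) < h f := hh f hf ▸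
          Finset.sum_pos (fun p _ => (hf.1 p).1) Finset.univ_nonempty
        exact_mod_cast this
      · have : (h f : ℝ) ≤ Fintype.card I := by
          rw [← hh f hf]
          simpa using Finset.sum_le_sum fun p (_ : p ∈ Finset.univ) => (hf.1 p).2
        exact_mod_cast this
  · intro N _ f hf g hg hfg
    rw [Function.onFun, Set.disjoint_left]
    rintro _ ⟨n, _, rfl⟩ ⟨n', _, hnn⟩
    refine hfg (funext fun p => ?_)
    have e : g p + (n' p : ℝ) = f p + n p := congrFun hnn p
    obtain ⟨hf1, hf2⟩ := hf.1 p
    obtain ⟨hg1, hg2⟩ := hg.1 p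
    have h1 : ((n' p : ℤ) : ℝ) < (n p : ℤ) + 1 := by push_cast; linarith
    have h2 : ((n p : ℤ) : ℝ) < (n' p : ℤ) + 1 := by push_cast; linarith
    have h3 : (n p : ℤ) = n' p := by
      have h1' : (n' p : ℤ) < n p + 1 := by exact_mod_cast h1
      have h2' : (n p : ℤ) < n' p + 1 := by exact_mod_cast h2
      omega
    have h4 : (n p : ℝ) = n' p := by exact_mod_cast h3
    linarith

/-! ### Lexicographic triangulation -/

/-- The first nonzero coordinate of `c` is positive. -/
def LexPos {J : Type*} [LT J] (c : J → ℝ) : Prop :=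
  ∃ j, 0 < c j ∧ ∀ i < j, c i = 0

theorem lexPos_or_lexPos_neg {J : Type*} [Fintype J] [LinearOrder J] {c : J → ℝ} (hc : c ≠ 0) :
    LexPos c ∨ LexPos (-c) := by
  obtain ⟨j, hj, hmin⟩ := (Set.toFinite {j | c j ≠ 0}).exists_minimal (Function.ne_iff.1 hc)
  have h0 : ∀ i < j, c i = 0 := fun i hi => by
    by_contra h
    exact absurd (hmin h hi.le) (not_le.2 hi)
  rcases lt_or_gt_of_ne hj with h | h
  · exact Or.inr ⟨j, by simpa using h, fun i hi => by simpa using h0 i hi⟩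
  · exact Or.inl ⟨j, h, h0⟩

/-- Maximize one coordinate after another, each time on the compact set where the earlier
coordinates keep their maximal values. -/
theorem IsCompact.exists_lexMax {J : Type*} [Fintype J] [LinearOrder J] {F : Set (J → ℝ)}
    (hF : IsCompact F) (hne : F.Nonempty) : ∃ l ∈ F, ∀ m ∈ F, ¬ LexPos (m - l) := by
  have key : ∀ s : Finset J, ∃ l ∈ F, ∀ m ∈ F, ∀ j ∈ s,
      (∀ i ∈ s, i < j → m i = l i) → m j ≤ l j := by
    intro s
    induction s using Finset.induction_on_max with
    | empty => obtain ⟨l, hl⟩ := hne; exact ⟨l, hl, by simp⟩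
    | insert a s ha ih =>
      obtain ⟨l, hl, hmax⟩ := ih
      have hK : IsCompact (F ∩ {m | ∀ i ∈ s, m i = l i}) := by
        refine hF.inter_right ?_
        simp only [Set.ofPred_forall]
        exact isClosed_iInter fun i => isClosed_iInter fun _ =>
          isClosed_eq (continuous_apply i) continuous_const
      obtain ⟨l', ⟨hl'F, hl's⟩, hl'⟩ := hK.exists_isMaxOn ⟨l, hl, fun _ _ => rfl⟩
        (continuous_apply a).continuousOn
      refine ⟨l', hl'F, fun m hm j hj hagree => ?_⟩
      rcases Finset.mem_insert.1 hj with rfl | hjs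
      · exact hl' ⟨hm, fun i hi =>
          (hagree i (Finset.mem_insert_of_mem hi) (ha i hi)).trans (hl's i hi)⟩
      · rw [hl's j hjs]
        exact hmax m hm j hjs fun i hi hij =>
          (hagree i (Finset.mem_insert_of_mem hi) hij).trans (hl's i hi)
  obtain ⟨l, hl, hmax⟩ := key Finset.univ
  refine ⟨l, hl, ?_⟩
  rintro m hm ⟨j, hj, hlt⟩
  have := hmax m hm j (Finset.mem_univ _) fun i _ hij => sub_eq_zero.1 (hlt i hij)
  simp only [Pi.sub_apply] at hj
  linarith

/-- `I` is the support of a lexicographically maximal nonnegative representation: no linear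
relation between the vectors `u j` that is lexicographically positive is nonnegative off `I`. -/
def LexFace {J κ : Type*} [Fintype J] [LT J] (u : J → κ → ℝ) (I : Set J) : Prop :=
  ∀ c : J → ℝ, (∀ k, ∑ j, c j * u j k = 0) → (∀ j ∉ I, 0 ≤ c j) → ¬ LexPos c

/-- The difference of the two coefficient vectors is a linear relation; it or its negative is
lexicographically positive, and the sign conditions contradict one of the two faces. For `I = I'`
this is linear independence over a face; for different faces it makes the open simplices disjoint.
-/
theorem LexFace.unique {J κ : Type*} [Fintype J] [LinearOrder J] {u : J → κ → ℝ} {I I' : Set J}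
    (hI : LexFace u I) (hI' : LexFace u I') {l l' : J → ℝ}
    (hl : ∀ j ∉ I, l j = 0) (hl' : ∀ j ∉ I', l' j = 0)
    (h0 : ∀ j ∉ I, 0 ≤ l' j) (h0' : ∀ j ∉ I', 0 ≤ l j)
    (h : ∀ k, ∑ j, l j * u j k = ∑ j, l' j * u j k) : l = l' := by
  by_contra hne
  rcases lexPos_or_lexPos_neg (sub_ne_zero.2 hne) with hp | hp
  · refine hI' _ (fun k => ?_) (fun j hj => ?_) hp
    · simp [sub_mul, h]
    · simp [hl' j hj, h0' j hj]
  · rw [neg_sub] at hp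
    refine hI _ (fun k => ?_) (fun j hj => ?_) hp
    · simp [sub_mul, h]
    · simp [hl j hj, h0 j hj]

/-- The nonnegative representations form a compact set, since coordinate `k₀` fixes their sum. At a
lexicographic maximum, a positive relation that is nonnegative off the support could be added in a
small multiple, giving a larger representation. -/
theorem exists_lexFace_repr {J κ : Type*} [Fintype J] [LinearOrder J] (u : J → κ → ℝ) (k₀ : κ)
    (hu : ∀ j, u j k₀ = 1) (l : J → ℝ) (hl : ∀ j, 0 ≤ l j) :
    ∃ l' : J → ℝ, (∀ j, 0 ≤ l' j) ∧ (∀ k, ∑ j, l' j * u j k = ∑ j, l j * u j k) ∧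
      LexFace u {j | l' j ≠ 0} := by
  set F : Set (J → ℝ) := {m | (∀ j, 0 ≤ m j) ∧ ∀ k, ∑ j, m j * u j k = ∑ j, l j * u j k} with hF
  have hcl : IsClosed F := by
    simp only [hF, Set.ofPred_and, Set.ofPred_forall]
    refine (isClosed_iInter fun j => isClosed_le continuous_const (continuous_apply j)).inter
      (isClosed_iInter fun k => isClosed_eq (by fun_prop) continuous_const)
  have hcomp : IsCompact F := by
    refine (isCompact_Icc (a := (0 : J → ℝ)) (b := fun _ => ∑ j, l j)).of_isClosed_subset hcl ?_
    rintro m ⟨hm1, hm2⟩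
    refine ⟨fun j => hm1 j, fun j => ?_⟩
    have := hm2 k₀
    simp only [hu, mul_one] at this
    rw [← this]
    exact Finset.single_le_sum (fun i _ => hm1 i) (Finset.mem_univ j)
  obtain ⟨m, ⟨hm1, hm2⟩, hmax⟩ := hcomp.exists_lexMax ⟨l, hl, fun _ => rfl⟩
  refine ⟨m, hm1, hm2, fun c hc hc0 hpos => ?_⟩
  have hev : ∀ᶠ e : ℝ in nhdsWithin 0 (Set.Ioi 0), ∀ j, 0 ≤ m j + e * c j := by
    rw [Filter.eventually_all]
    intro j
    by_cases hj : m j = 0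
    · filter_upwards [self_mem_nhdsWithin] with e he
      rw [hj, zero_add]
      exact mul_nonneg (le_of_lt he) (hc0 j (by simpa using hj))
    · have hc : Filter.Tendsto (fun e : ℝ => m j + e * c j) (nhds 0) (nhds (m j)) := by
        have : Continuous fun e : ℝ => m j + e * c j := by fun_prop
        simpa using this.tendsto 0
      exact nhdsWithin_le_nhds ((hc.eventually_const_lt
        (lt_of_le_of_ne (hm1 j) (Ne.symm hj))).mono fun _ h => h.le)
  obtain ⟨e, he, hepos⟩ := (hev.and self_mem_nhdsWithin).exists
  refine hmax (fun j => m j + e * c j) ⟨he, fun k => ?_⟩ ?_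
  · simp only [add_mul, Finset.sum_add_distrib, mul_assoc, ← Finset.mul_sum, hc, mul_zero,
      add_zero, hm2]
  · obtain ⟨j, hj, hlt⟩ := hpos
    exact ⟨j, by simpa using mul_pos hepos hj, fun i hi => by simp [hlt i hi]⟩

theorem extend_subtype_of_notMem {J : Type*} {I : Set J} (l : I → ℝ) {j : J} (hj : j ∉ I) :
    Function.extend Subtype.val l 0 j = 0 := by
  rw [Function.extend_apply' _ _ _ (by simpa using hj), Pi.zero_apply]

theorem extend_subtype_injective {J : Type*} (I : Set J) :
    Function.Injective fun l : I → ℝ => Function.extend Subtype.val l 0 := fun l l' h => by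
  ext p
  have := congrFun h p
  simpa only [Subtype.val_injective.extend_apply] using this

theorem sum_extend_subtype {J : Type*} [Fintype J] (I : Set J) [Fintype I] (l : I → ℝ)
    (g : J → ℝ) :
    ∑ j, Function.extend Subtype.val l 0 j * g j = ∑ p : I, l p * g p := by
  refine (Fintype.sum_of_injective Subtype.val Subtype.val_injective _ _ (fun j hj => ?_)
    fun p => ?_).symm
  · rw [Function.extend_apply' _ _ _ (by simpa using hj)]
    simp
  · rw [Subtype.val_injective.extend_apply]

/-! ### Ehrhart counting for unions of open simplices -/

/-- Ehrhart polynomiality for a set `C` of convex combinations of lattice points `u j` (in the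
hyperplane where the coordinate `k₀` is `1`) such that membership in `C` depends only on the support
of the coefficient vector. -/
theorem PolyCount.of_support {J κ : Type*} [Fintype J] [Finite κ] (u : J → κ → ℤ)
    (k₀ : κ) (hu : ∀ j, u j k₀ = 1) (C : Set (κ → ℝ)) (hC₀ : ∀ y ∈ C, y k₀ = 1)
    (hC : ∀ y ∈ C, ∃ l : J → ℝ, (∀ j, 0 ≤ l j) ∧ ∀ k, y k = ∑ j, l j * (u j k : ℝ))
    (hsupp : ∀ l m : J → ℝ, (∀ j, 0 ≤ l j) → (∀ j, 0 ≤ m j) → ∑ j, l j = 1 → ∑ j, m j = 1 →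
      (∀ j, l j = 0 ↔ m j = 0) → (fun k => ∑ j, l j * (u j k : ℝ)) ∈ C →
      (fun k => ∑ j, m j * (u j k : ℝ)) ∈ C) :
    PolyCount (fun N => {z : κ → ℤ | ∃ y ∈ C, ∀ k, (z k : ℝ) = N * y k}) := by
  classical
  -- Any order will do: it only selects the triangulation.
  let _ : LinearOrder J := LinearOrder.lift' (Fintype.equivFin J) (Fintype.equivFin J).injective
  set w : J → κ → ℝ := fun j k => (u j k : ℝ) with hw
  set B : Set (Set J) := {I | LexFace w I ∧ ∃ l : J → ℝ, (∀ j, 0 ≤ l j) ∧ ∑ j, l j = 1 ∧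
    (∀ j, l j ≠ 0 ↔ j ∈ I) ∧ (fun k => ∑ j, l j * w j k) ∈ C} with hB
  set A : Set J → ℕ → Set (J → ℝ) := fun I N => {l | (∀ j ∈ I, 0 < l j) ∧ (∀ j ∉ I, l j = 0) ∧
    (∀ k, ∃ m : ℤ, ∑ j, l j * w j k = m) ∧ ∑ j, l j = N} with hA
  -- On `A I N` the sums are integers, so the floor merely moves them to `ℤ`.
  set f : (J → ℝ) → κ → ℤ := fun l k => ⌊∑ j, l j * w j k⌋ with hf
  have hfA : ∀ I N, ∀ l ∈ A I N, ∀ k, (f l k : ℝ) = ∑ j, l j * w j k := by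
    rintro I N l ⟨-, -, h, -⟩ k
    obtain ⟨m, hm⟩ := h k
    simp [hf, hm]
  have hnn : ∀ I N, ∀ l ∈ A I N, ∀ j, 0 ≤ l j := by
    rintro I N l ⟨h1, h2, -⟩ j
    by_cases hj : j ∈ I
    · exact (h1 j hj).le
    · exact (h2 j hj).ge
  have huniq : ∀ N, ∀ I ∈ B, ∀ I' ∈ B, ∀ l ∈ A I N, ∀ l' ∈ A I' N, f l = f l' → l = l' := by
    intro N I hI I' hI' l hl l' hl' hff
    refine hI.1.unique hI'.1 hl.2.1 hl'.2.1 (fun j _ => hnn _ _ _ hl' j)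
      (fun j _ => hnn _ _ _ hl j) fun k => ?_
    rw [← hfA _ _ _ hl, ← hfA _ _ _ hl', hff]
  have hAP : ∀ I ∈ B, PolyCount (A I) := by
    intro I hI
    have hinj : Function.Injective fun (l : I → ℝ) k => ∑ p, l p * (u p k : ℝ) := by
      intro l l' hll
      exact extend_subtype_injective I <| hI.1.unique hI.1
        (fun j => extend_subtype_of_notMem l) (fun j => extend_subtype_of_notMem l')
        (fun j hj => (extend_subtype_of_notMem l' hj).ge)
        (fun j hj => (extend_subtype_of_notMem l hj).ge) (fun k => by
          rw [sum_extend_subtype, sum_extend_subtype]; exact congrFun hll k)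
    refine PolyCount.congr (PolyCount.image (PolyCount.openSimplex (fun p : I => u p) k₀
      (fun p => hu p) hinj) (fun _ l => Function.extend Subtype.val l 0) fun N _ =>
      (extend_subtype_injective I).injOn) fun N _ => ?_
    ext l
    constructor
    · rintro ⟨h1, h2, h3, h4⟩
      have hl : Function.extend Subtype.val (fun p : I => l p) 0 = l := by
        ext j
        by_cases hj : j ∈ I
        · exact Subtype.val_injective.extend_apply _ _ (⟨j, hj⟩ : I)
        · rw [extend_subtype_of_notMem _ hj, h2 j hj]
      refine ⟨fun p => l p, ⟨fun p => h1 p p.2, fun k => ?_, ?_⟩, hl⟩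
      · have := sum_extend_subtype I (fun p : I => l p) (fun j => w j k)
        rw [hl] at this
        obtain ⟨m, hm⟩ := h3 k
        exact ⟨m, this.symm.trans hm⟩
      · have := sum_extend_subtype I (fun p : I => l p) (fun _ => 1)
        rw [hl] at this
        simpa [h4] using this.symm
    · rintro ⟨l, ⟨h1, h2, h3⟩, rfl⟩
      refine ⟨fun j hj => ?_, fun j hj => ?_, fun k => ?_, ?_⟩
      · exact (h1 ⟨j, hj⟩).trans_eq (Subtype.val_injective.extend_apply l 0 ⟨j, hj⟩).symm
      · exact extend_subtype_of_notMem l hj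
      · rw [sum_extend_subtype]; exact h2 k
      · have := sum_extend_subtype I l (fun _ => 1)
        simpa [h3] using this
  have key : ∀ N : ℕ, 1 ≤ N → {z : κ → ℤ | ∃ y ∈ C, ∀ k, (z k : ℝ) = N * y k} =
      ⋃ I ∈ B, f '' A I N := by
    intro N hN
    have hN0 : (0 : ℝ) < N := by exact_mod_cast hN
    ext z
    simp only [Set.mem_iUnion, exists_prop]
    constructor
    · rintro ⟨y, hy, hz⟩
      obtain ⟨l₀, hl₀, hyl₀⟩ := hC y hy
      obtain ⟨l, hl, hll, hface⟩ := exists_lexFace_repr w k₀ (by simp [hw, hu]) l₀ hl₀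
      have hy' : ∀ k, y k = ∑ j, l j * w j k := fun k => by rw [hyl₀, hll]
      have hsum : ∑ j, l j = 1 := by
        have := hy' k₀
        simpa [hw, hu, hC₀ y hy] using this.symm
      have hmul : ∀ k, ∑ j, N * l j * w j k = z k := fun k => by
        simp only [mul_assoc, ← Finset.mul_sum]
        rw [← hy', hz]
      refine ⟨{j | l j ≠ 0}, ⟨hface, l, hl, hsum, fun j => Iff.rfl, ?_⟩, fun j => N * l j,
        ⟨fun j hj => ?_, fun j hj => ?_, fun k => ⟨z k, hmul k⟩, ?_⟩, ?_⟩
      · rwa [← (funext hy' : y = _)]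
      · exact mul_pos hN0 (lt_of_le_of_ne (hl j) (Ne.symm hj))
      · have : l j = 0 := by simpa using hj
        simp [this]
      · rw [← Finset.mul_sum, hsum, mul_one]
      · ext k
        simp [hf, hmul]
    · rintro ⟨I, hI, l, hl, rfl⟩
      obtain ⟨-, m, hm0, hm1, hmI, hmC⟩ := hI
      refine ⟨fun k => ∑ j, (l j / N) * w j k, ?_, fun k => ?_⟩
      · refine hsupp m _ hm0 (fun j => div_nonneg (hnn _ _ _ hl j) hN0.le) hm1 ?_ (fun j => ?_) hmC
        · rw [← Finset.sum_div, hl.2.2.2, div_self hN0.ne']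
        · rw [div_eq_zero_iff, or_iff_left hN0.ne', ← not_iff_not, ← ne_eq, hmI]
          exact ⟨fun h => (hl.1 j h).ne', fun h => by_contra fun h' => h (hl.2.1 j h')⟩
      · rw [hfA _ _ _ hl, Finset.mul_sum]
        refine Finset.sum_congr rfl fun j _ => ?_
        field_simp
  refine PolyCount.congr (PolyCount.biUnion (Set.toFinite B)
    (fun I hI => PolyCount.image (hAP I hI) (fun _ => f) fun N _ l hl l' hl' h =>
      huniq N I hI I hI l hl l' hl' h) ?_) key
  intro N _ I hI I' hI' hne
  rw [Function.onFun, Set.disjoint_left]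
  rintro _ ⟨l, hl, rfl⟩ ⟨l', hl', h⟩
  obtain rfl := huniq N I' hI' I hI l' hl' l hl h
  refine hne (Set.ext fun j => ?_)
  exact ⟨fun h => by_contra fun h' => (hl.1 j h).ne' (hl'.2.1 j h'),
    fun h => by_contra fun h' => (hl'.1 j h).ne' (hl.2.1 j h')⟩

/-! ### Covector cells in multiplicative coordinates -/

/-- The covector of `y` in multiplicative coordinates: the pairs `(v, i)` such that the largest
multiple of `w v` below `y` touches `y` in the nonzero coordinate `i`. -/
def mulCovector {A ι : Type*} (V : Set A) (w : A → ι → ℝ) (y : ι → ℝ) : Set (A × ι) :=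
  {p | p.1 ∈ V ∧ y p.2 ≠ 0 ∧ ∀ i, w p.1 i * y p.2 ≤ w p.1 p.2 * y i}

/-- The tropical polytope generated by the `w v`, in multiplicative homogeneous coordinates. -/
def mulPolytope {A ι : Type*} (V : Set A) (w : A → ι → ℝ) (o : ι) : Set (ι → ℝ) :=
  {y | y o = 1 ∧ (∀ i, 0 ≤ y i) ∧ ∀ i, y i ≠ 0 → ∃ v, (v, i) ∈ mulCovector V w y}

/-- The closed cell of the covector decomposition belonging to a covector `T`. -/
def mulClosedCell {A ι : Type*} (w : A → ι → ℝ) (o : ι) (T : Set (A × ι)) : Set (ι → ℝ) :=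
  {y | y o = 1 ∧ (∀ i, 0 ≤ y i) ∧ (∀ i, (∀ v, (v, i) ∉ T) → y i = 0) ∧
    ∀ p ∈ T, ∀ i, w p.1 i * y p.2 ≤ w p.1 p.2 * y i}

/-- The pseudovertices in multiplicative coordinates. -/
def mulPseudovertices {A ι : Type*} (V : Set A) (w : A → ι → ℝ) (o : ι) : Set (ι → ℝ) :=
  {y | y ∈ mulPolytope V w o ∧
    ∀ z ∈ mulPolytope V w o, mulCovector V w z = mulCovector V w y → z = y}

section

variable {A ι : Type*} {V : Set A} {w : A → ι → ℝ} {o : ι} {T : Set (A × ι)} {y z : ι → ℝ}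

theorem ne_zero_iff_exists_mulCovector (hy : y ∈ mulPolytope V w o) (i : ι) :
    y i ≠ 0 ↔ ∃ v, (v, i) ∈ mulCovector V w y :=
  ⟨hy.2.2 i, fun ⟨_, hv⟩ => hv.2.1⟩

theorem eq_zero_iff_of_mulCovector_eq (hy : y ∈ mulPolytope V w o) (hz : z ∈ mulPolytope V w o)
    (h : mulCovector V w z = mulCovector V w y) (i : ι) : z i = 0 ↔ y i = 0 := by
  rw [← not_iff_not, ← ne_eq, ← ne_eq, ne_zero_iff_exists_mulCovector hy,
    ne_zero_iff_exists_mulCovector hz, h]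

theorem mem_mulClosedCell (hy : y ∈ mulPolytope V w o) :
    y ∈ mulClosedCell w o (mulCovector V w y) := by
  refine ⟨hy.1, hy.2.1, fun i hi => ?_, fun p hp => hp.2.2⟩
  by_contra h
  obtain ⟨v, hv⟩ := hy.2.2 i h
  exact hi v hv

theorem mulClosedCell_subset (hT : ∀ p ∈ T, p.1 ∈ V) :
    mulClosedCell w o T ⊆ mulPolytope V w o := by
  rintro y ⟨h1, h2, h3, h4⟩
  refine ⟨h1, h2, fun i hi => ?_⟩
  by_contra! h
  refine hi (h3 i fun v hv => h v ⟨hT _ hv, hi, h4 _ hv⟩)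

theorem weight_pos_of_mem_mulCovector (hwo : ∀ v, w v o = 1)
    (hy : y ∈ mulPolytope V w o) {v : A} {i : ι} (h : (v, i) ∈ mulCovector V w y) :
    0 < w v i ∧ 0 < y i := by
  have hyi : 0 < y i := lt_of_le_of_ne (hy.2.1 i) (Ne.symm h.2.1)
  have := h.2.2 o
  simp only [hwo, hy.1, one_mul, mul_one] at this
  exact ⟨hyi.trans_le this, hyi⟩

/-- A nonzero coordinate `i` is touched by some generator `v`; comparison at `o` gives `y i ≤ w v
i`. -/
theorem mulPolytope_bounded [Finite ι] (hV : V.Finite) (hw : ∀ v i, 0 ≤ w v i)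
    (hwo : ∀ v, w v o = 1) : ∃ B : ℝ, ∀ y ∈ mulPolytope V w o, ∀ i, y i ≤ B := by
  cases nonempty_fintype ι
  have hs : ∀ v ∈ V, ∀ i, w v i ≤ ∑ v ∈ hV.toFinset, ∑ i, w v i := fun v hv i =>
    (Finset.single_le_sum (fun i _ => hw v i) (Finset.mem_univ i)).trans
      (Finset.single_le_sum (f := fun v => ∑ i, w v i)
        (fun v _ => Finset.sum_nonneg fun i _ => hw v i) (hV.mem_toFinset.2 hv))
  refine ⟨∑ v ∈ hV.toFinset, ∑ i, w v i, fun y hy i => ?_⟩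
  by_cases hi : y i = 0
  · rw [hi]
    exact Finset.sum_nonneg fun v _ => Finset.sum_nonneg fun i _ => hw v i
  · obtain ⟨v, hv⟩ := hy.2.2 i hi
    have := hv.2.2 o
    simp only [hwo, hy.1, one_mul, mul_one] at this
    exact this.trans (hs v hv.1 i)

theorem convex_mulClosedCell : Convex ℝ (mulClosedCell w o T) := by
  rintro y ⟨h1, h2, h3, h4⟩ z ⟨h1', h2', h3', h4'⟩ a b ha hb hab
  refine ⟨?_, fun i => ?_, fun i hi => ?_, fun p hp i => ?_⟩ <;>
    simp only [Pi.add_apply, Pi.smul_apply, smul_eq_mul]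
  · rw [h1, h1', mul_one, mul_one, hab]
  · exact add_nonneg (mul_nonneg ha (h2 i)) (mul_nonneg hb (h2' i))
  · rw [h3 i hi, h3' i hi, mul_zero, mul_zero, add_zero]
  · linarith [mul_le_mul_of_nonneg_left (h4 p hp i) ha, mul_le_mul_of_nonneg_left (h4' p hp i) hb]

theorem isCompact_mulClosedCell [Finite ι] (hV : V.Finite) (hw : ∀ v i, 0 ≤ w v i)
    (hwo : ∀ v, w v o = 1) (hT : ∀ p ∈ T, p.1 ∈ V) : IsCompact (mulClosedCell w o T) := by
  obtain ⟨B, hB⟩ := mulPolytope_bounded hV hw hwo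
  refine (isCompact_Icc (a := (0 : ι → ℝ)) (b := fun _ => B)).of_isClosed_subset ?_
    fun y hy => ⟨hy.2.1, hB y (mulClosedCell_subset hT hy)⟩
  simp only [mulClosedCell, Set.ofPred_and, Set.ofPred_forall]
  refine (isClosed_eq (continuous_apply o) continuous_const).inter
    ((isClosed_iInter fun i => isClosed_le continuous_const (continuous_apply i)).inter
    ((isClosed_iInter fun i => isClosed_iInter fun _ =>
      isClosed_eq (continuous_apply i) continuous_const).inter
    (isClosed_iInter fun p => isClosed_iInter fun _ => isClosed_iInter fun i =>
      isClosed_le (by fun_prop) (by fun_prop))))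

/-- A pseudovertex is determined by its covector, and only finitely many covectors exist. -/
theorem finite_mulPseudovertices [Finite ι] (hV : V.Finite) :
    (mulPseudovertices V w o).Finite := by
  have h1 : ((V ×ˢ (Set.univ : Set ι)).powerset).Finite :=
    (hV.prod Set.finite_univ).finite_subsets
  refine Set.Finite.of_finite_image (f := mulCovector V w) (h1.subset ?_) ?_
  · rintro _ ⟨y, -, rfl⟩ p hp
    exact ⟨hp.1, Set.mem_univ _⟩
  · exact fun y hy z hz h => hz.2 y hy.1 h

/-- A difference of coordinates that vanishes at a point of a closed cell vanishes at all
points with the same covector as that point. -/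
theorem eq_of_mulCovector_eq (hw : ∀ v i, 0 ≤ w v i) (hwo : ∀ v, w v o = 1)
    (hT : ∀ p ∈ T, p.1 ∈ V) (hy : y ∈ mulClosedCell w o T) (hz : z ∈ mulPolytope V w o)
    (h : mulCovector V w z = mulCovector V w y) {p : A × ι} (hp : p ∈ T) {i : ι}
    (he : w p.1 i * y p.2 = w p.1 p.2 * y i) : w p.1 i * z p.2 = w p.1 p.2 * z i := by
  have hyP := mulClosedCell_subset hT hy
  have h0 := eq_zero_iff_of_mulCovector_eq hyP hz h
  by_cases hyp : y p.2 = 0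
  · rw [hyp, mul_zero, eq_comm, mul_eq_zero, ← h0 i] at he
    rw [(h0 _).2 hyp, mul_zero, eq_comm, mul_eq_zero]
    exact he
  · have hpy : p ∈ mulCovector V w y := ⟨hT p hp, hyp, hy.2.2.2 p hp⟩
    obtain ⟨hwp, hyp'⟩ := weight_pos_of_mem_mulCovector hwo hyP hpy
    have hpz : p ∈ mulCovector V w z := h ▸ hpy
    refine le_antisymm (hpz.2.2 i) ?_
    by_cases hyi : y i = 0
    · rw [(h0 i).2 hyi, mul_zero]
      exact mul_nonneg (hw _ _) (hz.2.1 _)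
    · have hiy : (p.1, i) ∈ mulCovector V w y := by
        refine ⟨hT p hp, hyi, fun j => ?_⟩
        have h5 := mul_le_mul_of_nonneg_left (hpy.2.2 j) (hw p.1 i)
        have h6 : w p.1 p.2 * (w p.1 j * y i) ≤ w p.1 p.2 * (w p.1 i * y j) := by
          calc w p.1 p.2 * (w p.1 j * y i) = w p.1 i * (w p.1 j * y p.2) := by
                linear_combination (- w p.1 j) * he
            _ ≤ _ := h5
            _ = _ := by ring
        exact le_of_mul_le_mul_left h6 hwp
      have hiz : (p.1, i) ∈ mulCovector V w z := h ▸ hiy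
      exact hiz.2.2 p.2

/-- If `z ≠ y` has the covector of `y`, all constraints tight at `y` are tight at `z`. A short
segment around `y` in the direction `z - y` then stays in the closed cell, on both sides, so `y` is
not extreme. -/
theorem extremePoints_mulClosedCell_subset [Finite ι] (hV : V.Finite) (hw : ∀ v i, 0 ≤ w v i)
    (hwo : ∀ v, w v o = 1) (hT : ∀ p ∈ T, p.1 ∈ V) :
    (mulClosedCell w o T).extremePoints ℝ ⊆ mulPseudovertices V w o := by
  intro y hy
  rw [mem_extremePoints] at hy
  obtain ⟨hyT, hext⟩ := hy
  have hyP := mulClosedCell_subset hT hyT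
  refine ⟨hyP, fun z hz h => ?_⟩
  by_contra hne
  have h0 := eq_zero_iff_of_mulCovector_eq hyP hz h
  have hTfin : T.Finite := ((hV.prod Set.finite_univ).subset fun p hp => ⟨hT p hp, Set.mem_univ _⟩)
  have hsmall : ∀ a c : ℝ, 0 ≤ a → (a = 0 → c = 0) → ∀ᶠ e : ℝ in nhds 0, 0 ≤ a + e * c := by
    intro a c ha hac
    rcases ha.eq_or_lt with h | h
    · simp [hac h.symm, ← h]
    · have hc : Filter.Tendsto (fun e : ℝ => a + e * c) (nhds 0) (nhds a) := by
        have : Continuous fun e : ℝ => a + e * c := by fun_prop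
        simpa using this.tendsto 0
      exact (hc.eventually_const_lt h).mono fun _ h => h.le
  have hev : ∀ᶠ e : ℝ in nhds 0, y + e • (z - y) ∈ mulClosedCell w o T := by
    have e1 : ∀ᶠ e : ℝ in nhds 0, ∀ i, 0 ≤ y i + e * (z i - y i) :=
      Filter.eventually_all.2 fun i => hsmall _ _ (hyP.2.1 i) fun hi => by
        rw [(h0 i).2 hi, hi, sub_zero]
    have e2 : ∀ᶠ e : ℝ in nhds 0, ∀ p ∈ T, ∀ i, 0 ≤ (w p.1 p.2 * y i - w p.1 i * y p.2) +
        e * ((w p.1 p.2 * z i - w p.1 i * z p.2) - (w p.1 p.2 * y i - w p.1 i * y p.2)) := by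
      rw [Filter.eventually_all_finite hTfin]
      refine fun p hp => Filter.eventually_all.2 fun i =>
        hsmall _ _ (sub_nonneg.2 (hyT.2.2.2 p hp i)) fun hi => ?_
      rw [eq_of_mulCovector_eq hw hwo hT hyT hz h hp (sub_eq_zero.1 hi).symm, hi]
      ring
    filter_upwards [e1, e2] with e h1 h2
    refine ⟨?_, h1, fun i hi => ?_, fun p hp i => ?_⟩ <;>
      simp only [Pi.add_apply, Pi.smul_apply, Pi.sub_apply, smul_eq_mul]
    · rw [hyP.1, hz.1]; ring
    · have := hyT.2.2.1 i hi
      rw [(h0 i).2 this, this]; ring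
    · linarith [h2 p hp i]
  have hneg : Filter.Tendsto (fun e : ℝ => -e) (nhds 0) (nhds 0) := by
    simpa using (continuous_neg (G := ℝ)).tendsto 0
  obtain ⟨e, ⟨h1, h2⟩, h3⟩ := (((hev.and (hneg.eventually hev)).filter_mono
    (nhdsWithin_le_nhds (s := Set.Ioi 0))).and self_mem_nhdsWithin).exists
  have hseg : y ∈ openSegment ℝ (y + e • (z - y)) (y + (-e) • (z - y)) := by
    refine ⟨1 / 2, 1 / 2, by norm_num, by norm_num, by norm_num, ?_⟩
    module
  have := (hext _ h1 _ h2 hseg)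
  have h4 : e • (z - y) = 0 := by simpa using this
  rcases smul_eq_zero.1 h4 with h | h
  · exact (ne_of_gt h3) h
  · exact hne (sub_eq_zero.1 h)

/-- Krein–Milman for the closed cell; its extreme points are among the finitely many `g j`, whose
convex hull is already closed. -/
theorem exists_eq_sum_mulPseudovertices [Finite ι] (hV : V.Finite) (hw : ∀ v i, 0 ≤ w v i)
    (hwo : ∀ v, w v o = 1) (hT : ∀ p ∈ T, p.1 ∈ V)
    {J : Type*} [Fintype J] (g : J → ι → ℝ)
    (hg : mulPseudovertices V w o ∩ mulClosedCell w o T ⊆ Set.range g)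
    (hy : y ∈ mulClosedCell w o T) :
    ∃ l : J → ℝ, (∀ j, 0 ≤ l j) ∧ ∀ i, y i = ∑ j, l j * g j i := by
  rw [← closure_convexHull_extremePoints (isCompact_mulClosedCell hV hw hwo hT)
    convex_mulClosedCell] at hy
  have hsub : (mulClosedCell w o T).extremePoints ℝ ⊆ Set.range g := fun x hx =>
    hg ⟨extremePoints_mulClosedCell_subset hV hw hwo hT hx, hx.1⟩
  have hcl : closure (convexHull ℝ ((mulClosedCell w o T).extremePoints ℝ)) ⊆
      convexHull ℝ (Set.range g) :=
    closure_minimal (convexHull_mono hsub) ((Set.finite_range g).isClosed_convexHull ℝ)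
  have := hcl hy
  rw [convexHull_range_eq_exists_affineCombination (R := ℝ)] at this
  obtain ⟨s, l, hl0, hl1, hl⟩ := this
  classical
  refine ⟨fun j => if j ∈ s then l j else 0, fun j => ?_, fun i => ?_⟩
  · beta_reduce
    split_ifs with h
    · exact hl0 j h
    · exact le_rfl
  · rw [← hl, Finset.affineCombination_eq_linear_combination _ _ _ hl1]
    simp [Finset.sum_apply]

end

/-! ### Relatively open cells and the count for the whole polytope -/

section

variable {A ι : Type*} {V : Set A} {w : A → ι → ℝ} {o : ι} {T : Set (A × ι)} {y z : ι → ℝ}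

/-- Otherwise `y` is nonzero on the support of `w v`, and `v` touches `y` where the ratio `y i / w v
i` is minimal. -/
theorem exists_eq_zero_of_notMem_mulCovector [Finite ι] (hw : ∀ v i, 0 ≤ w v i)
    (hwo : ∀ v, w v o = 1) (hy : y ∈ mulPolytope V w o) {v : A} (hv : v ∈ V)
    (h : ∀ i, (v, i) ∉ mulCovector V w y) : ∃ i, w v i ≠ 0 ∧ y i = 0 := by
  by_contra! hne
  obtain ⟨i, hi, hmin⟩ := (Set.toFinite {i | w v i ≠ 0}).exists_minimalFor (fun i => y i / w v i) _
    ⟨o, by simp [hwo]⟩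
  have hpos : ∀ j, w v j ≠ 0 → 0 < w v j := fun j hj => lt_of_le_of_ne (hw v j) (Ne.symm hj)
  refine h i ⟨hv, hne i hi, fun j => ?_⟩
  by_cases hj : w v j = 0
  · simp only [hj, zero_mul]
    exact mul_nonneg (hw _ _) (hy.2.1 _)
  · have : y i / w v i ≤ y j / w v j := by
      rcases le_total (y i / w v i) (y j / w v j) with h | h
      · exact h
      · exact hmin hj h
    rw [div_le_div_iff₀ (hpos i hi) (hpos j hj)] at this
    simp only
    linarith

/-- Relatively open cells: the covector of a convex combination of points of the closed cell of `T`
is `T` or not depending only on the support of the coefficients. -/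
theorem mulCovector_eq_of_support [Finite ι] (hw : ∀ v i, 0 ≤ w v i)
    (hwo : ∀ v, w v o = 1) {J : Type*} [Fintype J] {g : J → ι → ℝ}
    (hT : ∀ p ∈ T, p.1 ∈ V) (hg : ∀ j, g j ∈ mulClosedCell w o T) {l m : J → ℝ}
    (hl : ∀ j, 0 ≤ l j) (hm : ∀ j, 0 ≤ m j) (hl1 : ∑ j, l j = 1) (hm1 : ∑ j, m j = 1)
    (hlm : ∀ j, l j = 0 ↔ m j = 0)
    (hY : mulCovector V w (fun i => ∑ j, l j * g j i) = T) :
    (fun i => ∑ j, m j * g j i) ∈ mulPolytope V w o ∧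
      mulCovector V w (fun i => ∑ j, m j * g j i) = T := by
  have hmem : ∀ l : J → ℝ, (∀ j, 0 ≤ l j) → ∑ j, l j = 1 →
      (fun i => ∑ j, l j * g j i) ∈ mulClosedCell w o T := fun l hl hl1 => by
    have := (convex_mulClosedCell (w := w) (o := o) (T := T)).sum_mem
      (t := Finset.univ) (fun j _ => hl j) hl1 fun j _ => hg j
    convert this using 1
    ext i
    simp [Finset.sum_apply]
  -- A sum of nonnegative terms vanishes only if every term does, so the support of the coefficients
  -- decides which constraints are tight.
  have hzero : ∀ φ : J → ℝ, (∀ j, 0 ≤ φ j) → (∑ j, l j * φ j = 0 ↔ ∑ j, m j * φ j = 0) := by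
    intro φ hφ
    rw [Finset.sum_eq_zero_iff_of_nonneg fun j _ => mul_nonneg (hl j) (hφ j),
      Finset.sum_eq_zero_iff_of_nonneg fun j _ => mul_nonneg (hm j) (hφ j)]
    simp only [mul_eq_zero, hlm]
  have hYT := hmem l hl hl1
  have hZT := hmem m hm hm1
  set Y : ι → ℝ := fun i => ∑ j, l j * g j i with hYdef
  set Z : ι → ℝ := fun i => ∑ j, m j * g j i with hZdef
  have h0 : ∀ i, Y i = 0 ↔ Z i = 0 := fun i => hzero (fun j => g j i) fun j => (hg j).2.1 i
  have hdiff : ∀ p ∈ T, ∀ i, w p.1 p.2 * Y i - w p.1 i * Y p.2 = 0 ↔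
      w p.1 p.2 * Z i - w p.1 i * Z p.2 = 0 := by
    intro p hp i
    have e : ∀ l : J → ℝ, w p.1 p.2 * (∑ j, l j * g j i) - w p.1 i * (∑ j, l j * g j p.2) =
        ∑ j, l j * (w p.1 p.2 * g j i - w p.1 i * g j p.2) := fun l => by
      rw [Finset.mul_sum, Finset.mul_sum, ← Finset.sum_sub_distrib]
      exact Finset.sum_congr rfl fun j _ => by ring
    rw [hYdef, hZdef]
    simp only [e]
    exact hzero _ fun j => sub_nonneg.2 ((hg j).2.2.2 p hp i)
  have hYP := mulClosedCell_subset hT hYT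
  have hZP := mulClosedCell_subset hT hZT
  refine ⟨hZP, Set.Subset.antisymm ?_ fun p hp => ?_⟩
  · rintro ⟨v, i⟩ hvi
    obtain ⟨hwi, hZi⟩ := weight_pos_of_mem_mulCovector hwo hZP hvi
    -- If `v` touches `Y` at some `i'`, the equality between `i` and `i'` carries over from `Z` to
    -- `Y`. If `v` touches `Y` nowhere, then `Y`, and so `Z`, vanishes at a coordinate in the
    -- support of `w v`, and `v` cannot touch `Z` either.
    by_cases hex : ∃ i', (v, i') ∈ T
    · obtain ⟨i', hi'⟩ := hex
      have hz : w v i' * Z i - w v i * Z i' = 0 := by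
        refine sub_eq_zero.2 (le_antisymm (hvi.2.2 i') (hZT.2.2.2 _ hi' i))
      have hy := sub_eq_zero.1 ((hdiff _ hi' i).2 hz)
      simp only at hy
      have hi'' : (v, i') ∈ mulCovector V w Y := by rw [hY]; exact hi'
      obtain ⟨hwi', -⟩ := weight_pos_of_mem_mulCovector hwo hYP hi''
      rw [← hY]
      refine ⟨hvi.1, fun h => hZi.ne' ((h0 i).1 h), fun k => ?_⟩
      have h5 := mul_le_mul_of_nonneg_left (hi''.2.2 k) hwi.le
      refine le_of_mul_le_mul_left (a := w v i') ?_ hwi'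
      simp only at h5 ⊢
      calc w v i' * (w v k * Y i) = w v i * (w v k * Y i') := by linear_combination w v k * hy
        _ ≤ _ := h5
        _ = _ := by ring
    · push Not at hex
      obtain ⟨k, hk, hYk⟩ := exists_eq_zero_of_notMem_mulCovector hw hwo hYP hvi.1
        fun i => by rw [hY]; exact hex i
      have h1 := hvi.2.2 k
      simp only [(h0 k).1 hYk, mul_zero] at h1
      exact absurd (mul_pos (lt_of_le_of_ne (hw v k) (Ne.symm hk)) hZi) (not_lt.2 h1)
  · have hp' : p ∈ mulCovector V w Y := by rw [hY]; exact hp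
    exact ⟨hT p hp, fun h => hp'.2.1 ((h0 _).2 h), hZT.2.2.2 p hp⟩

/-- Ehrhart polynomiality of a tropical polytope in multiplicative coordinates, all of whose
pseudovertices become lattice points after scaling the coordinates by `D`. -/
theorem polyCount_mulPolytope [Finite ι] (hV : V.Finite) (hw : ∀ v i, 0 ≤ w v i)
    (hwo : ∀ v, w v o = 1) (D : ι → ℝ) (hDo : D o = 1) (hD : ∀ i, D i ≠ 0)
    (hint : ∀ y ∈ mulPseudovertices V w o, ∀ i, ∃ m : ℤ, D i * y i = m) :
    PolyCount (fun N => {z : ι → ℤ | ∃ y ∈ mulPolytope V w o, ∀ i, (z i : ℝ) = N * (D i * y i)}) := by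
  choose! u hu using hint
  set B : Set (Set (A × ι)) := mulCovector V w '' mulPolytope V w o with hB
  have hBfin : B.Finite := by
    refine ((hV.prod (Set.finite_univ (α := ι))).finite_subsets).subset ?_
    rintro _ ⟨y, -, rfl⟩ p hp
    exact ⟨hp.1, Set.mem_univ _⟩
  have hcell : ∀ T ∈ B, PolyCount (fun N => {z : ι → ℤ | ∃ y ∈
      (fun y i => D i * y i) '' {y | y ∈ mulPolytope V w o ∧ mulCovector V w y = T},
        ∀ i, (z i : ℝ) = N * y i}) := by
    rintro T ⟨y₀, hy₀, rfl⟩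
    set T := mulCovector V w y₀ with hTdef
    have hT : ∀ p ∈ T, p.1 ∈ V := fun p hp => hp.1
    let J := {y // y ∈ mulPseudovertices V w o ∩ mulClosedCell w o T}
    have hJ : Finite J := ((finite_mulPseudovertices hV).inter_of_left _)
    cases nonempty_fintype J
    have hsum : ∀ (l : J → ℝ) i, ∑ j, l j * (u j.1 i : ℝ) = D i * ∑ j, l j * j.1 i := by
      intro l i
      rw [Finset.mul_sum]
      refine Finset.sum_congr rfl fun j _ => ?_
      rw [← hu j.1 j.2.1]; ring
    refine PolyCount.of_support (fun j : J => u j.1) o (fun j => ?_) _ ?_ ?_ ?_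
    · have := hu j.1 j.2.1 o
      rw [hDo, j.2.1.1.1, one_mul] at this
      exact_mod_cast this.symm
    · rintro _ ⟨y, ⟨hy, -⟩, rfl⟩
      simp [hDo, hy.1]
    · rintro _ ⟨y, ⟨hy, hyT⟩, rfl⟩
      obtain ⟨l, hl, hyl⟩ := exists_eq_sum_mulPseudovertices (y := y) hV hw hwo hT
        (fun j : J => j.1) (by simp [J]) (hyT ▸ mem_mulClosedCell hy)
      exact ⟨l, hl, fun i => by rw [hsum, ← hyl]⟩
    · rintro l m hl hm hl1 hm1 hlm ⟨y, ⟨hy, hyT⟩, hye⟩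
      have hye' : y = fun i => ∑ j : J, l j * j.1 i := funext fun i => by
        have := congrFun hye i
        simp only [hsum] at this
        exact mul_left_cancel₀ (hD i) this
      rw [hye'] at hyT
      exact ⟨_, mulCovector_eq_of_support hw hwo hT (fun j : J => j.2.2) hl hm hl1 hm1 hlm hyT,
        funext fun i => (hsum m i).symm⟩
  refine PolyCount.congr (PolyCount.biUnion hBfin hcell ?_) fun N _ => ?_
  · intro N hN T _ T' _ hne
    rw [Function.onFun, Set.disjoint_left]
    rintro z ⟨_, ⟨y, ⟨hy, hyT⟩, rfl⟩, hz⟩ ⟨_, ⟨y', ⟨hy', hyT'⟩, rfl⟩, hz'⟩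
    have hN0 : (N : ℝ) ≠ 0 := by exact_mod_cast (Nat.one_le_iff_ne_zero.1 hN)
    have : y = y' := funext fun i => by
      have := (hz i).symm.trans (hz' i)
      exact mul_left_cancel₀ (hD i) (mul_left_cancel₀ hN0 this)
    exact hne (by rw [← hyT, ← hyT', this])
  · ext z
    simp only [Set.mem_iUnion, exists_prop, Set.mem_ofPred_eq]
    constructor
    · rintro ⟨y, hy, hz⟩
      exact ⟨_, ⟨y, hy, rfl⟩, _, ⟨y, ⟨hy, rfl⟩, rfl⟩, hz⟩
    · rintro ⟨T, -, _, ⟨y, ⟨hy, -⟩, rfl⟩, hz⟩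
      exact ⟨y, hy, hz⟩

/-! ### Coordinates of pseudovertices -/

/-- The nonzero coordinates of a pseudovertex lie in every multiplicative group containing the
nonzero weights. -/
theorem mulPseudovertices_mem_subgroup [Finite ι] (hV : V.Finite)
    (G : Subgroup ℝˣ)
    (hG : ∀ v ∈ V, ∀ i, w v i = 0 ∨ ∃ g ∈ G, (g : ℝ) = w v i)
    (hy : y ∈ mulPseudovertices V w o) (i : ι) : y i = 0 ∨ ∃ g ∈ G, (g : ℝ) = y i := by
  classical
  -- Coordinates outside `R` are all multiplied by `1 + e`. A nonzero tight comparison never links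
  -- `R` to its complement, since ratios of nonzero weights lie in `G`; strict comparisons survive
  -- for small `e`. So the covector is unchanged, and a pseudovertex forces `R` to be everything.
  set R : Set ι := {i | y i = 0 ∨ ∃ g ∈ G, (g : ℝ) = y i} with hR
  have hoR : o ∈ R := Or.inr ⟨1, G.one_mem, by simp [hy.1.1]⟩
  set s : ℝ → ι → ℝ := fun e i => if i ∈ R then 1 else 1 + e with hs
  have hlink : ∀ v ∈ V, ∀ i j, w v i * y j = w v j * y i → w v i * y j ≠ 0 → i ∈ R → j ∈ R := by
    intro v hv i j h hne hi
    obtain ⟨hwi, hyj⟩ := mul_ne_zero_iff.1 hne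
    obtain ⟨hwj, hyi⟩ := mul_ne_zero_iff.1 (h ▸ hne)
    obtain ⟨a, ha, ha'⟩ := (hG v hv i).resolve_left hwi
    obtain ⟨b, hb, hb'⟩ := (hG v hv j).resolve_left hwj
    obtain ⟨c, hc, hc'⟩ := hi.resolve_left hyi
    refine Or.inr ⟨b * c * a⁻¹, G.mul_mem (G.mul_mem hb hc) (G.inv_mem ha), ?_⟩
    push_cast
    rw [hb', hc', ha', ← h]
    field_simp
  have hev : ∀ᶠ e : ℝ in nhds 0, ∀ v ∈ V, ∀ i j,
      (w v i * (s e j * y j) ≤ w v j * (s e i * y i) ↔ w v i * y j ≤ w v j * y i) := by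
    rw [Filter.eventually_all_finite hV]
    intro v hv
    rw [Filter.eventually_all]
    intro i
    rw [Filter.eventually_all]
    intro j
    have hcont : ∀ i j, Filter.Tendsto (fun e => w v i * (s e j * y j)) (nhds 0)
        (nhds (w v i * y j)) := by
      intro i j
      have h1 : Continuous fun e => w v i * (s e j * y j) := by
        by_cases hj : j ∈ R <;> simp only [hs, hj, if_true, if_false] <;> fun_prop
      have := h1.tendsto 0
      simpa [hs] using this
    rcases lt_trichotomy (w v i * y j) (w v j * y i) with h | h | h
    · filter_upwards [(hcont i j).eventually_lt (hcont j i) h] with e he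
      exact ⟨fun _ => h.le, fun _ => he.le⟩
    · refine Filter.Eventually.of_forall fun e => ?_
      have : s e j = s e i ∨ w v i * y j = 0 := by
        by_cases hne : w v i * y j = 0
        · exact Or.inr hne
        · refine Or.inl ?_
          have : i ∈ R ↔ j ∈ R := ⟨hlink v hv i j h hne, hlink v hv j i h.symm (h ▸ hne)⟩
          simp only [hs, this]
      rw [mul_left_comm, mul_left_comm (w v j), ← h]
      rcases this with h' | h' <;> simp [h']
    · filter_upwards [(hcont j i).eventually_lt (hcont i j) h] with e he
      exact ⟨fun h' => absurd he (not_lt.2 h'), fun h' => absurd h (not_lt.2 h')⟩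
  obtain ⟨e, he, hepos⟩ := ((hev.filter_mono (nhdsWithin_le_nhds (s := Set.Ioi 0))).and
    self_mem_nhdsWithin).exists
  have hepos : 0 < e := hepos
  have hspos : ∀ i, 0 < s e i := fun i => by
    simp only [hs]; split_ifs <;> linarith
  have hcov : mulCovector V w (fun i => s e i * y i) = mulCovector V w y := by
    ext ⟨v, i⟩
    simp only [mulCovector, Set.mem_ofPred_eq, mul_ne_zero_iff, (hspos i).ne', ne_eq,
      not_false_eq_true, true_and]
    refine and_congr_right fun hv => and_congr_right fun _ => forall_congr' fun j => he v hv j i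
  have hmem : (fun i => s e i * y i) ∈ mulPolytope V w o := by
    refine ⟨by simp [hs, hoR, hy.1.1], fun i => mul_nonneg (hspos i).le (hy.1.2.1 i), fun i hi => ?_⟩
    rw [hcov]
    exact hy.1.2.2 i (right_ne_zero_of_mul hi)
  have heq := congrFun (hy.2 _ hmem hcov) i
  by_contra hi
  have hi' : i ∉ R := hi
  simp only [hs, hi', if_false] at heq
  have h3 : e * y i = 0 := by linarith
  rcases mul_eq_zero.1 h3 with h | h
  · exact hepos.ne' h
  · exact hi (Or.inl h)

end

/-! ### Passage between tropical and multiplicative coordinates -/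

/-- The exponential `x ↦ b ^ x` from the max-tropical semiring to the nonnegative reals. -/
def tropExp (b : ℕ) (x : MaxTrop) : ℝ :=
  WithBot.recBotCoe 0 (fun r : ℝ => (b : ℝ) ^ r) x

section tropExp

variable {b : ℕ}

@[simp] theorem tropExp_bot : tropExp b ⊥ = 0 := rfl

@[simp] theorem tropExp_coe (r : ℝ) : tropExp b (r : MaxTrop) = (b : ℝ) ^ r := rfl

@[simp] theorem tropExp_zero : tropExp b 0 = 1 := by
  rw [← WithBot.coe_zero, tropExp_coe, Real.rpow_zero]

theorem tropExp_nonneg (x : MaxTrop) : 0 ≤ tropExp b x := by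
  induction x using WithBot.recBotCoe with
  | bot => simp
  | coe r => rw [tropExp_coe]; positivity

theorem tropExp_add (hb : 2 ≤ b) (x y : MaxTrop) :
    tropExp b (x + y) = tropExp b x * tropExp b y := by
  induction x using WithBot.recBotCoe with
  | bot => simp
  | coe r =>
    induction y using WithBot.recBotCoe with
    | bot => simp
    | coe s =>
      have : (0 : ℝ) < b := by positivity
      rw [← WithBot.coe_add, tropExp_coe, tropExp_coe, tropExp_coe, Real.rpow_add this]

theorem tropExp_coe_pos (hb : 2 ≤ b) (r : ℝ) : 0 < tropExp b (r : MaxTrop) := by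
  have : (0 : ℝ) < b := by positivity
  rw [tropExp_coe]
  exact Real.rpow_pos_of_pos this r

theorem tropExp_le_iff (hb : 2 ≤ b) (x y : MaxTrop) : tropExp b x ≤ tropExp b y ↔ x ≤ y := by
  induction x using WithBot.recBotCoe with
  | bot => simp [tropExp_nonneg]
  | coe r =>
    induction y using WithBot.recBotCoe with
    | bot => simpa using tropExp_coe_pos hb r
    | coe s =>
      have : (1 : ℝ) < b := by exact_mod_cast hb
      rw [tropExp_coe, tropExp_coe, Real.rpow_le_rpow_left_iff this, WithBot.coe_le_coe]

theorem tropExp_injective (hb : 2 ≤ b) : Function.Injective (tropExp b) := fun x y h =>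
  le_antisymm ((tropExp_le_iff hb x y).1 h.le) ((tropExp_le_iff hb y x).1 h.ge)

theorem tropExp_eq_zero_iff (hb : 2 ≤ b) (x : MaxTrop) : tropExp b x = 0 ↔ x = ⊥ :=
  (tropExp_injective hb).eq_iff' tropExp_bot

theorem exists_tropExp_eq (hb : 2 ≤ b) {y : ℝ} (hy : 0 ≤ y) : ∃ x, tropExp b x = y := by
  rcases hy.eq_or_lt with rfl | hy
  · exact ⟨⊥, rfl⟩
  · refine ⟨(Real.logb b y : ℝ), ?_⟩
    rw [tropExp_coe, Real.rpow_logb (by positivity) _ hy]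
    exact_mod_cast (by omega : b ≠ 1)

theorem tropExp_tropLog (hb : 2 ≤ b) (n : ℕ) : tropExp b (tropLog b n) = n := by
  unfold tropLog
  split_ifs with h
  · simp [h]
  · rw [tropExp_coe, Real.rpow_logb (by positivity) _ (by positivity)]
    exact_mod_cast (by omega : b ≠ 1)

theorem tropExp_natCast (k : ℕ) : tropExp b ((k : ℝ) : MaxTrop) = (b : ℝ) ^ k := by
  rw [tropExp_coe, Real.rpow_natCast]

end tropExp

/-- The condition `⊕ lam_j = 0` is the combination formula at the extra coordinate `none`.
Conversely, one touching generator per homogeneous coordinate suffices to write `x`. -/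
theorem mem_tropConv_iff {d : ℕ} {V : Set (Fin d → MaxTrop)} {x : Fin d → MaxTrop} :
    x ∈ tropConv V ↔ ∀ i, tropHom x i ≠ ⊥ → ∃ v, (v, i) ∈ covector V x := by
  constructor
  · rintro ⟨n, lam, v, hv, hlam, hx⟩ i hi
    have hsup : ∀ i, tropHom x i = Finset.univ.sup fun j => lam j + tropHom (v j) i := by
      rintro (_ | i)
      · simpa [tropHom] using hlam.symm
      · rw [hx]; rfl
    have hne : (Finset.univ : Finset (Fin n)).Nonempty := by
      by_contra h
      rw [Finset.not_nonempty_iff_eq_empty] at h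
      rw [hsup, h, Finset.sup_empty] at hi
      exact hi rfl
    obtain ⟨j, -, hj⟩ := Finset.exists_mem_eq_sup _ hne fun j => lam j + tropHom (v j) i
    refine ⟨v j, hv j, hi, lam j, fun k => ?_, ?_⟩
    · rw [hsup]
      exact Finset.le_sup (f := fun j => lam j + tropHom (v j) k) (Finset.mem_univ j)
    · rw [hsup, hj]
  · intro h
    have h' : ∀ i, ∃ (v : Fin d → MaxTrop) (lam : MaxTrop), v ∈ V ∧
        (∀ k, lam + tropHom v k ≤ tropHom x k) ∧ lam + tropHom v i = tropHom x i := by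
      intro i
      by_cases hi : tropHom x i = ⊥
      -- At a coordinate equal to `⊥` any generator serves, with coefficient `⊥`; coordinate `none`
      -- supplies one.
      · obtain ⟨v, hv, -⟩ := h none (by simp [tropHom])
        exact ⟨v, ⊥, hv, by simp, by simp [hi]⟩
      · obtain ⟨v, hv, -, lam, h1, h2⟩ := h i hi
        exact ⟨v, lam, hv, h1, h2⟩
    choose v lam hv hle heq using h'
    let e := (Fintype.equivFin (Option (Fin d))).symm
    have hsup : ∀ i, Finset.univ.sup (fun j => lam (e j) + tropHom (v (e j)) i) = tropHom x i := by
      intro i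
      refine le_antisymm (Finset.sup_le fun j _ => hle _ i) ?_
      rw [← heq i]
      have := Finset.le_sup (f := fun j => lam (e j) + tropHom (v (e j)) i)
        (Finset.mem_univ (e.symm i))
      simpa using this
    refine ⟨_, fun j => lam (e j), fun j => v (e j), fun j => hv _, ?_, funext fun i => ?_⟩
    · simpa [tropHom] using hsup none
    · exact (hsup (some i)).symm

/-- Multiplicative homogeneous coordinates of a point. -/
def expHom (b : ℕ) {d : ℕ} (x : Fin d → MaxTrop) (i : Option (Fin d)) : ℝ :=
  tropExp b (tropHom x i)

theorem expHom_nonneg {b d : ℕ} (x : Fin d → MaxTrop) (i : Option (Fin d)) : 0 ≤ expHom b x i :=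
  tropExp_nonneg _

@[simp] theorem expHom_none {b d : ℕ} (x : Fin d → MaxTrop) : expHom b x none = 1 :=
  tropExp_zero

theorem expHom_some {b d : ℕ} (x : Fin d → MaxTrop) (i : Fin d) :
    expHom b x (some i) = tropExp b (x i) := rfl

theorem expHom_injective {b d : ℕ} (hb : 2 ≤ b) :
    Function.Injective (expHom b : (Fin d → MaxTrop) → _) := fun _ _ h =>
  funext fun i => tropExp_injective hb (congrFun h (some i))

theorem exists_expHom_eq {b d : ℕ} (hb : 2 ≤ b) {y : Option (Fin d) → ℝ} (hy : ∀ i, 0 ≤ y i)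
    (hy0 : y none = 1) : ∃ x, expHom b x = y := by
  choose x hx using fun i => exists_tropExp_eq hb (hy (some i))
  refine ⟨x, funext fun i => ?_⟩
  cases i with
  | none => rw [expHom_none, hy0]
  | some i => exact hx i

theorem covector_eq_mulCovector {b d : ℕ} (hb : 2 ≤ b) (V : Set (Fin d → MaxTrop))
    (x : Fin d → MaxTrop) : covector V x = mulCovector V (expHom b) (expHom b x) := by
  ext ⟨v, j⟩
  simp only [covector, mulCovector, Set.mem_ofPred_eq]
  refine and_congr_right fun _ => ?_
  rw [expHom, ne_eq, ne_eq, tropExp_eq_zero_iff hb]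
  refine and_congr_right fun hxj => ⟨?_, fun h => ?_⟩
  · rintro ⟨lam, h1, h2⟩ i
    have h3 := (tropExp_le_iff hb _ _).2 (h1 i)
    rw [tropExp_add hb] at h3
    rw [← h2, tropExp_add hb]
    have := mul_le_mul_of_nonneg_left h3 (tropExp_nonneg (b := b) (tropHom v j))
    simp only [expHom]
    linarith
  -- Comparison at `none` gives `x_j ≤ v_j`, so `v_j` is finite and `x_j - v_j` is a legitimate
  -- scalar.
  · have h0 := h none
    simp only [expHom_none, one_mul, mul_one] at h0
    have h0 := (tropExp_le_iff hb _ _).1 h0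
    obtain ⟨r, hr⟩ := WithBot.ne_bot_iff_exists.1 hxj
    obtain ⟨s, hs⟩ := WithBot.ne_bot_iff_exists.1 (ne_bot_of_le_ne_bot hxj h0)
    have hlam : ((r - s : ℝ) : MaxTrop) + tropHom v j = tropHom x j := by
      rw [← hr, ← hs, ← WithBot.coe_add, sub_add_cancel]
    refine ⟨(r - s : ℝ), fun i => ?_, hlam⟩
    rw [← tropExp_le_iff hb, tropExp_add hb]
    have h1 := h i
    rw [← hlam, tropExp_add hb] at h1
    have hpos : 0 < tropExp b (tropHom v j) := hs ▸ tropExp_coe_pos hb s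
    refine le_of_mul_le_mul_left ?_ hpos
    simp only [expHom] at h1
    linarith

theorem mem_tropConv_iff_expHom {b d : ℕ} (hb : 2 ≤ b) {V : Set (Fin d → MaxTrop)}
    {x : Fin d → MaxTrop} :
    x ∈ tropConv V ↔ expHom b x ∈ mulPolytope V (expHom b) none := by
  rw [mem_tropConv_iff, covector_eq_mulCovector hb]
  refine ⟨fun h => ⟨expHom_none x, expHom_nonneg x, fun i hi => h i ?_⟩, fun h i hi => h.2.2 i ?_⟩
  · rwa [expHom, ne_eq, tropExp_eq_zero_iff hb] at hi
  · rwa [expHom, ne_eq, tropExp_eq_zero_iff hb]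

theorem exists_isPseudovertex {b d : ℕ} (hb : 2 ≤ b) {V : Set (Fin d → MaxTrop)}
    {y : Option (Fin d) → ℝ} (hy : y ∈ mulPseudovertices V (expHom b) none) :
    ∃ x, expHom b x = y ∧ IsPseudovertex V x := by
  obtain ⟨x, rfl⟩ := exists_expHom_eq hb hy.1.2.1 hy.1.1
  refine ⟨x, rfl, (mem_tropConv_iff_expHom hb).2 hy.1, fun z hz h => ?_⟩
  rw [covector_eq_mulCovector hb, covector_eq_mulCovector hb] at h
  exact expHom_injective hb (hy.2 _ ((mem_tropConv_iff_expHom hb).1 hz) h)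

/-! ### Lattice points of the dilates -/

theorem finite_tropDilate_inter_tropLattice {b d : ℕ} (hb : 2 ≤ b) {V : Set (Fin d → MaxTrop)}
    (hV : V.Finite) (k : ℕ) : (tropDilate k (tropConv V) ∩ tropLattice b d).Finite := by
  obtain ⟨B, hB⟩ := mulPolytope_bounded (w := expHom b) hV (fun v => expHom_nonneg v)
    fun v => expHom_none v
  refine ((Set.finite_Iic (fun _ : Fin d => ⌊(b : ℝ) ^ k * B⌋₊)).image
    fun n i => tropLog b (n i)).subset ?_
  rintro _ ⟨⟨x, hx, rfl⟩, n, hn⟩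
  refine ⟨n, fun i => ?_, hn.symm⟩
  have h1 := congrArg (tropExp b) (congrFun hn i)
  rw [tropExp_tropLog hb, tropExp_add hb, tropExp_natCast] at h1
  refine Nat.le_floor ?_
  rw [← h1]
  exact mul_le_mul_of_nonneg_left (hB _ ((mem_tropConv_iff_expHom hb).1 hx) (some i))
    (by positivity)

/-- The factor `b ^ k` is split as `b ^ (k - K) * b ^ K`: the first is the Ehrhart dilation, the
second clears denominators. The extra coordinate is not scaled by `b ^ K`, so it records the
dilation factor. -/
theorem tropDilate_inter_tropLattice_eq {b d : ℕ} (hb : 2 ≤ b) (V : Set (Fin d → MaxTrop))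
    {K k : ℕ} (hk : K ≤ k) : tropDilate k (tropConv V) ∩ tropLattice b d =
      (fun (z : Option (Fin d) → ℤ) i => tropLog b (z (some i)).toNat) ''
        {z | ∃ y ∈ mulPolytope V (expHom b) none, ∀ i, (z i : ℝ) =
          (b ^ (k - K) : ℕ) * (i.elim 1 (fun _ => (b : ℝ) ^ K) * y i)} := by
  have hpow : ((b ^ (k - K) : ℕ) : ℝ) * (b : ℝ) ^ K = (b : ℝ) ^ k := by
    push_cast
    rw [← pow_add, Nat.sub_add_cancel hk]
  ext x'
  constructor
  · rintro ⟨⟨x, hx, rfl⟩, n, hn⟩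
    refine ⟨fun i => i.elim ((b ^ (k - K) : ℕ) : ℤ) fun i => n i,
      ⟨_, (mem_tropConv_iff_expHom hb).1 hx, ?_⟩, ?_⟩
    · rintro (_ | i)
      · simp
      · have h1 := congrArg (tropExp b) (congrFun hn i)
        rw [tropExp_tropLog hb, tropExp_add hb, tropExp_natCast] at h1
        simp only [Option.elim_some, ← mul_assoc, hpow, expHom_some]
        simpa using h1.symm
    · rw [hn]
      simp
  · rintro ⟨z, ⟨y, hy, hz⟩, rfl⟩
    obtain ⟨x, rfl⟩ := exists_expHom_eq hb hy.2.1 hy.1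
    refine ⟨⟨x, (mem_tropConv_iff_expHom hb).2 hy, funext fun i => tropExp_injective hb ?_⟩, _, rfl⟩
    have h1 := hz (some i)
    simp only [Option.elim_some, ← mul_assoc, hpow, expHom_some] at h1
    have h0 : 0 ≤ z (some i) := by
      have : (0 : ℝ) ≤ z (some i) := h1 ▸ mul_nonneg (by positivity) (tropExp_nonneg _)
      exact_mod_cast this
    rw [tropExp_tropLog hb, tropExp_add hb, tropExp_natCast, ← h1, ← Int.cast_natCast,
      Int.toNat_of_nonneg h0]

/-- Substitute `N = b ^ k / b ^ K` in the Ehrhart polynomial. The least case `k = K` is `N = 1`, so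
polynomiality from `N = 1` on suffices. -/
theorem tropEnum_eq_eval {b d : ℕ} (hb : 2 ≤ b) {V : Set (Fin d → MaxTrop)} (hV : V.Finite) (K : ℕ)
    (hint : ∀ y ∈ mulPseudovertices V (expHom b) none, ∀ i, ∃ m : ℤ, (b : ℝ) ^ K * y i = m) :
    ∃ q : Polynomial ℝ, ∀ k : ℕ, K ≤ k →
      (tropEnum b (tropConv V) k : ℝ) = q.eval ((b : ℝ) ^ k) := by
  have hb0 : (b : ℝ) ≠ 0 := by positivity
  obtain ⟨q, hq⟩ := polyCount_mulPolytope (w := expHom b) (o := none) hV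
    (fun v => expHom_nonneg v) (fun v => expHom_none v)
    (fun i => i.elim 1 (fun _ => (b : ℝ) ^ K)) rfl
    (by rintro (_ | i) <;> simp [hb0]) (by
      rintro y hy (_ | i)
      · exact ⟨1, by simp [hy.1.1]⟩
      · exact hint y hy (some i))
  refine ⟨q.comp (Polynomial.C ((b : ℝ) ^ K)⁻¹ * Polynomial.X), fun k hk => ?_⟩
  rw [tropEnum, tropDilate_inter_tropLattice_eq hb V hk, Set.InjOn.ncard_image,
    (hq (b ^ (k - K)) (Nat.one_le_pow _ _ (by omega))).2]
  · simp only [Polynomial.eval_comp, Polynomial.eval_mul, Polynomial.eval_C, Polynomial.eval_X]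
    congr 1
    push_cast
    rw [eq_inv_mul_iff_mul_eq₀ (by positivity), ← pow_add, Nat.add_sub_cancel' hk]
  · rintro z ⟨y, hy, hz⟩ z' ⟨y', hy', hz'⟩ h
    have hnn : ∀ (z : Option (Fin d) → ℤ) (y : Option (Fin d) → ℝ),
        y ∈ mulPolytope V (expHom b) none → (∀ i, (z i : ℝ) =
          (b ^ (k - K) : ℕ) * (i.elim 1 (fun _ => (b : ℝ) ^ K) * y i)) → ∀ i, 0 ≤ z (some i) := by
      intro z y hy hz i
      have : (0 : ℝ) ≤ z (some i) := by
        rw [hz]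
        exact mul_nonneg (by positivity) (mul_nonneg (by simp) (hy.2.1 _))
      exact_mod_cast this
    ext (_ | i)
    · have : (z none : ℝ) = z' none := by rw [hz, hz', hy.1, hy'.1]
      exact_mod_cast this
    · have h1 := congrArg (tropExp b) (congrFun h i)
      rw [tropExp_tropLog hb, tropExp_tropLog hb] at h1
      have h2 : (z (some i)).toNat = (z' (some i)).toNat := by exact_mod_cast h1
      rw [← Int.toNat_of_nonneg (hnn z y hy hz i), h2, Int.toNat_of_nonneg (hnn z' y' hy' hz' i)]

theorem mulPseudovertices_eq_zpow {b d : ℕ} (hb : 2 ≤ b) {V : Set (Fin d → MaxTrop)}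
    (hV : V.Finite) (hlat : V ⊆ tropNat d) {y : Option (Fin d) → ℝ}
    (hy : y ∈ mulPseudovertices V (expHom b) none) (i : Option (Fin d)) :
    y i = 0 ∨ ∃ m : ℤ, y i = (b : ℝ) ^ m := by
  have hb0 : (b : ℝ) ≠ 0 := by positivity
  have hG : ∀ v ∈ V, ∀ i, expHom b v i = 0 ∨
      ∃ g ∈ Subgroup.zpowers (Units.mk0 (b : ℝ) hb0), (g : ℝ) = expHom b v i := by
    rintro v hv (_ | i)
    · exact Or.inr ⟨1, Subgroup.one_mem _, by simp⟩
    · rw [expHom_some]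
      rcases hlat hv i with h | ⟨m, h⟩
      · exact Or.inl (by rw [h, tropExp_bot])
      · exact Or.inr ⟨_, ⟨m, rfl⟩, by rw [h, tropExp_natCast]; simp⟩
  rcases mulPseudovertices_mem_subgroup hV _ hG hy i with h | ⟨_, ⟨m, rfl⟩, hm⟩
  · exact Or.inl h
  · exact Or.inr ⟨m, by simpa using hm.symm⟩

/-! ### The main theorem -/

theorem mainTheorem1 (b : ℕ) (hb : 2 ≤ b) (d : ℕ) (P V : Set (Fin d → MaxTrop))
    (hV : IsTropVertexSet P V) (hlat : V ⊆ tropNat d) :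
    (∀ k : ℕ, (tropDilate k P ∩ tropLattice b d).Finite) ∧
    ((∀ x, IsPseudovertex V x → x ∈ tropNat d) →
      ∃ q : Polynomial ℝ, ∀ k : ℕ, (tropEnum b P k : ℝ) = q.eval ((b : ℝ) ^ k)) ∧
    ((∀ v ∈ V, ∀ i, v i ≠ ⊥) →
      ∃ q : Polynomial ℝ, ∀ k : ℕ, (tropEnum b P k : ℝ) = q.eval ((b : ℝ) ^ k)) ∧
    ∃ (q : Polynomial ℝ) (K : ℕ), ∀ k : ℕ, K ≤ k →
      (tropEnum b P k : ℝ) = q.eval ((b : ℝ) ^ k) := by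
  obtain ⟨hfin, hmin⟩ := hV
  obtain rfl : tropConv V = P := hmin.prop
  have hb0 : (b : ℝ) ≠ 0 := by positivity
  have hb1 : (1 : ℝ) < b := by exact_mod_cast hb
  refine ⟨finite_tropDilate_inter_tropLattice hb hfin, fun hpv => ?_, fun hV => ?_, ?_⟩
  · obtain ⟨q, hq⟩ := tropEnum_eq_eval hb hfin 0 (by
      rintro y hy (_ | i)
      · exact ⟨1, by simp [hy.1.1]⟩
      · obtain ⟨x, rfl, hx⟩ := exists_isPseudovertex hb hy
        rw [expHom_some]
        rcases hpv x hx i with h | ⟨m, h⟩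
        · exact ⟨0, by simp [h]⟩
        · exact ⟨(b : ℤ) ^ m, by rw [h, tropExp_natCast]; simp⟩)
    exact ⟨q, fun k => hq k (Nat.zero_le k)⟩
  · obtain ⟨q, hq⟩ := tropEnum_eq_eval hb hfin 0 (by
      intro y hy i
      -- Some generator touches `y` at `none`, hence lies below `y`; its finite coordinates are at
      -- least `1` after exponentiation. So the exponent of `b` in `y i` is nonnegative.
      have h1 : 1 ≤ y i := by
        obtain ⟨v, hv⟩ := hy.1.2.2 none (by simp [hy.1.1])
        have h2 := hv.2.2 i
        simp only [expHom_none, one_mul, hy.1.1, mul_one] at h2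
        refine le_trans ?_ h2
        cases i with
        | none => simp
        | some i =>
          rw [expHom_some]
          obtain ⟨m, h⟩ := (hlat (show v ∈ V from hv.1) i).resolve_left (hV v hv.1 i)
          rw [h, tropExp_natCast]
          exact one_le_pow₀ hb1.le
      rcases mulPseudovertices_eq_zpow hb hfin hlat hy i with h | ⟨m, h⟩
      · linarith
      · rw [h, one_le_zpow_iff_right₀ hb1] at h1
        lift m to ℕ using h1
        exact ⟨(b : ℤ) ^ m, by rw [h]; simp⟩)
    exact ⟨q, fun k => hq k (Nat.zero_le k)⟩
  -- There are finitely many pseudovertices, so one `K` outweighs all negative exponents.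
  · have hev : ∀ᶠ K : ℕ in Filter.atTop, ∀ y ∈ mulPseudovertices V (expHom b) none, ∀ i,
        ∃ m : ℤ, (b : ℝ) ^ K * y i = m := by
      rw [Filter.eventually_all_finite (finite_mulPseudovertices hfin)]
      intro y hy
      rw [Filter.eventually_all]
      intro i
      rcases mulPseudovertices_eq_zpow hb hfin hlat hy i with h | ⟨m, h⟩
      · exact Filter.Eventually.of_forall fun K => ⟨0, by simp [h]⟩
      · filter_upwards [Filter.eventually_ge_atTop m.natAbs] with K hK
        refine ⟨(b : ℤ) ^ (K + m).toNat, ?_⟩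
        rw [h, ← zpow_natCast, ← zpow_add₀ hb0, Int.cast_pow, Int.cast_natCast, ← zpow_natCast,
          Int.toNat_of_nonneg (by omega)]
    obtain ⟨K, hK⟩ := hev.exists
    obtain ⟨q, hq⟩ := tropEnum_eq_eval hb hfin K hK
    exact ⟨q, K, hq⟩

end
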